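/- Let $k$ be a field, $\Lambda$ a (unital, associative, not necessarily finite-dimensional) $k$-algebra, and $\mathrm{mod}\,\Lambda$ the category of finite-dimensional left $\Lambda$-modules. For $M,N\in\mathrm{mod}\,\Lambda$ write $M\le_{\mathrm{deg}}N$ if there are $X\in\mathrm{mod}\,\Lambda$ and an exact sequence of $\Lambda$-modules $0\to X\to X\oplus M\to N\to 0$. For $M,N\in\mathrm{mod}\,\Lambda$ with $\dim_k M=\dim_k N$ write $M\le_{\mathrm{Hom}}N$ if $\dim_k\mathrm{Hom}_\Lambda(X,M)\le\dim_k\mathrm{Hom}_\Lambda(X,N)$ for all $X\in\mathrm{mod}\,\Lambda$. Let $M\in\mathrm{mod}\,\Lambda$ be such that $\mathrm{End}_\Lambda(M)$ is a division ring (possibly of $k$-dimension greater than $1$). Then $M$ is minimal in the Hom-order and in the degeneration order; that is, for every $N\in\mathrm{mod}\,\Lambda$: 1. if $\dim_k N=\dim_k M$ and $N\le_{\mathrm{Hom}}M$, then $N\cong M$; 2. if $N\le_{\mathrm{deg}}M$, then $N\cong M$. -/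

import Mathlib

universe u w v

/-- `M ≤_Hom N`: for every finite-dimensional `Λ`-module `X`,
`dim_k Hom_Λ(X, M) ≤ dim_k Hom_Λ(X, N)`. -/
def HomLE (k : Type u) (Λ : Type w) [Field k] [Ring Λ] [Algebra k Λ]
    (M N : Type v)
    [AddCommGroup M] [Module k M] [Module Λ M] [IsScalarTower k Λ M]
    [AddCommGroup N] [Module k N] [Module Λ N] [IsScalarTower k Λ N] : Prop :=
  ∀ (X : Type v) [AddCommGroup X] [Module k X] [Module Λ X] [IsScalarTower k Λ X]
    [Module.Finite k X],
    Module.finrank k (X →ₗ[Λ] M) ≤ Module.finrank k (X →ₗ[Λ] N)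

/-- `M ≤_deg N`: there are a finite-dimensional `Λ`-module `X` and an exact sequence
`0 → X → X ⊕ M → N → 0` of `Λ`-modules. -/
def DegLE (k : Type u) (Λ : Type w) [Field k] [Ring Λ] [Algebra k Λ]
    (M N : Type v)
    [AddCommGroup M] [Module k M] [Module Λ M] [IsScalarTower k Λ M]
    [AddCommGroup N] [Module k N] [Module Λ N] [IsScalarTower k Λ N] : Prop :=
  ∃ (X : Type v) (_ : AddCommGroup X) (_ : Module k X) (_ : Module Λ X)
    (_ : IsScalarTower k Λ X) (_ : Module.Finite k X)
    (f : X →ₗ[Λ] X × M) (g : X × M →ₗ[Λ] N),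
    Function.Injective f ∧ Function.Exact f g ∧ Function.Surjective g

/-- `M` is minimal in the Hom-order. The Hom-order compares modules of the same `k`-dimension
(without this convention `0 ≤_Hom M` would hold for every `M`). -/
def IsHomMinimal (k : Type u) (Λ : Type w) [Field k] [Ring Λ] [Algebra k Λ]
    (M : Type v) [AddCommGroup M] [Module k M] [Module Λ M] [IsScalarTower k Λ M] : Prop :=
  ∀ (N : Type v) [AddCommGroup N] [Module k N] [Module Λ N] [IsScalarTower k Λ N]
    [Module.Finite k N],
    Module.finrank k N = Module.finrank k M → HomLE k Λ N M → Nonempty (N ≃ₗ[Λ] M)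

/-- `M` is minimal in the degeneration order. -/
def IsDegMinimal (k : Type u) (Λ : Type w) [Field k] [Ring Λ] [Algebra k Λ]
    (M : Type v) [AddCommGroup M] [Module k M] [Module Λ M] [IsScalarTower k Λ M] : Prop :=
  ∀ (N : Type v) [AddCommGroup N] [Module k N] [Module Λ N] [IsScalarTower k Λ N]
    [Module.Finite k N],
    DegLE k Λ N M → Nonempty (N ≃ₗ[Λ] M)

/-- The ring `R` is a division ring: it is nonzero and every nonzero element is invertible. -/
def IsDivRing (R : Type*) [Ring R] : Prop :=
  Nontrivial R ∧ ∀ a : R, a ≠ 0 → IsUnit a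

/-!
A module `M` whose endomorphism ring is a division ring is minimal because, given a nonzero map
`g : M → N` with image `J ⊆ N`, the inequality `N ≤_Hom M` tested on `J` yields a nonzero map
`J → M`. The composite `M → J → M` is a nonzero endomorphism of `M`, hence invertible, so `g` is
injective, and `dim N = dim M` makes it an isomorphism (`isHomMinimal_of_isDivRing_end`).
A degeneration gives equal dimensions and a Hom-inequality, by left exactness of `Hom(Y, -)`
(`DegLE.finrank_eq`, `DegLE.homLE`), so the degeneration order is covered as well.

The main point is the existence of a nonzero map `M → N` (`HomLE.exists_ne_zero`), which asks for
information on maps out of `M` while the hypothesis concerns maps into `M`. Choose `a 1, …, a n`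
in `Λ` that detect `Λ`-linearity of maps `M → N`, and for `P = M, N` let `C_P` send a tuple of
`k`-linear maps `φ i : N → P` to `∑ i, (a i ∘ φ i - φ i ∘ a i)`. The cokernel of `C_M` is dual
to `Hom_Λ(M, N)` (`exists_commuting_of_not_surjective`), so `C_M` is surjective if there is no
nonzero map `M → N`; `C_N` never is, as its values have trace zero
(`commutatorMap_not_surjective`). Sources and targets of `C_M` and `C_N` have the same dimensions,
so then `dim ker C_N > dim ker C_M`. But the relations that define `ker C_P` can be read as a
presentation of a `Λ`-module `X` with `ker C_P = Hom_Λ(X, P)`; a finite-dimensional quotient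
of it shows `dim ker C_N ≤ dim ker C_M` (`HomLE.finrank_ker_commutatorMap_le`).
-/

/-! ### Spaces of `Λ`-linear maps -/

/-- Left composition with `f`, as a `k`-linear map between spaces of `Λ`-linear maps. -/
def postcomp (k : Type*) {Λ : Type*} [Field k] [Ring Λ] [Algebra k Λ] (Y : Type*) {P Q : Type*}
    [AddCommGroup Y] [Module Λ Y]
    [AddCommGroup P] [Module k P] [Module Λ P] [IsScalarTower k Λ P]
    [AddCommGroup Q] [Module k Q] [Module Λ Q] [IsScalarTower k Λ Q]
    (f : P →ₗ[Λ] Q) : (Y →ₗ[Λ] P) →ₗ[k] (Y →ₗ[Λ] Q) where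
  toFun h := f ∘ₗ h
  map_add' h h' := LinearMap.comp_add h h' f
  map_smul' c h := by
    ext y
    exact f.map_smul_of_tower c (h y)

theorem finite_hom (k : Type*) (Λ : Type*) [Field k] [Ring Λ] [Algebra k Λ] (P Q : Type*)
    [AddCommGroup P] [Module k P] [Module Λ P] [IsScalarTower k Λ P] [Module.Finite k P]
    [AddCommGroup Q] [Module k Q] [Module Λ Q] [IsScalarTower k Λ Q] [Module.Finite k Q] :
    Module.Finite k (P →ₗ[Λ] Q) :=
  Module.Finite.of_injective (LinearMap.restrictScalarsₗ k Λ P Q k)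
    (LinearMap.restrictScalars_injective k)

/-! ### From degenerations to the Hom-order -/

section Degeneration

variable {k : Type u} {Λ : Type w} [Field k] [Ring Λ] [Algebra k Λ] {N M : Type v}
  [AddCommGroup N] [Module k N] [Module Λ N] [IsScalarTower k Λ N] [Module.Finite k N]
  [AddCommGroup M] [Module k M] [Module Λ M] [IsScalarTower k Λ M]

theorem DegLE.finrank_eq (h : DegLE k Λ N M) : Module.finrank k N = Module.finrank k M := by
  obtain ⟨X, _, _, _, _, _, f, g, hf, hfg, hg⟩ := h
  have h1 := LinearMap.finrank_range_add_finrank_ker (g.restrictScalars k)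
  have h2 := LinearMap.finrank_range_of_inj (f := f.restrictScalars k) hf
  have h3 : LinearMap.ker (g.restrictScalars k) = LinearMap.range (f.restrictScalars k) :=
    LinearMap.exact_iff.mp hfg
  have h4 : LinearMap.range (g.restrictScalars k) = ⊤ := LinearMap.range_eq_top.mpr hg
  rw [h3, h2, h4, finrank_top, Module.finrank_prod] at h1
  omega

/-- Left exactness of `Hom(Y, -)` on `0 → X → X ⊕ N → M → 0` bounds `dim Hom(Y, X ⊕ N)` by
`dim Hom(Y, X) + dim Hom(Y, M)`. -/
theorem DegLE.homLE [Module.Finite k M] (h : DegLE k Λ N M) : HomLE k Λ N M := by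
  obtain ⟨X, _, _, _, _, _, f, g, hf, hfg, hg⟩ := h
  intro Y _ _ _ _ _
  have := finite_hom k Λ Y X
  have := finite_hom k Λ Y N
  have := finite_hom k Λ Y M
  have := finite_hom k Λ Y (X × N)
  have h1 := LinearMap.finrank_range_add_finrank_ker (postcomp k Y g)
  have h2 := LinearMap.finrank_range_le (postcomp k Y f)
  have h3 : LinearMap.ker (postcomp k Y g) ≤ LinearMap.range (postcomp k Y f) := by
    intro u hu
    have hu' : ∀ y, ∃ x, f x = u y := fun y =>
      (hfg (u y)).mp (LinearMap.congr_fun (LinearMap.mem_ker.mp hu) y)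
    choose s hs using hu'
    refine ⟨{ toFun := s, map_add' := ?_, map_smul' := ?_ }, LinearMap.ext hs⟩
    · intro y z
      apply hf
      simp [hs]
    · intro c y
      apply hf
      simp [hs]
  have h4 := Submodule.finrank_mono h3
  have h5 := Submodule.finrank_le (LinearMap.range (postcomp k Y g))
  have h6 : Module.finrank k (Y →ₗ[Λ] X) + Module.finrank k (Y →ₗ[Λ] N) ≤
      Module.finrank k (Y →ₗ[Λ] X × N) := by
    rw [← Module.finrank_prod]
    refine LinearMap.finrank_le_finrank_of_injective
      (f := (postcomp k Y (LinearMap.inl Λ X N)).coprod (postcomp k Y (LinearMap.inr Λ X N))) ?_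
    rintro ⟨a, b⟩ ⟨a', b'⟩ hab
    have hab' := fun y => LinearMap.congr_fun hab y
    ext y
    · simpa [postcomp] using congrArg Prod.fst (hab' y)
    · simpa [postcomp] using congrArg Prod.snd (hab' y)
  omega

end Degeneration

/-! ### The commutator map on tuples of linear maps -/

section Commutator

variable {k : Type*} {Λ : Type*} [Field k] [Ring Λ] [Algebra k Λ]
  {ι : Type*} [Fintype ι] (a : ι → Λ)
  (N P : Type*)
  [AddCommGroup N] [Module k N] [Module Λ N] [IsScalarTower k Λ N]
  [AddCommGroup P] [Module k P] [Module Λ P] [IsScalarTower k Λ P]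

/-- The map `(φ i)ᵢ ↦ ∑ i, (a i ∘ φ i - φ i ∘ a i)` on tuples of `k`-linear maps `N → P`. -/
def commutatorMap : (ι → N →ₗ[k] P) →ₗ[k] (N →ₗ[k] P) where
  toFun φ := ∑ i, (Algebra.lsmul k k P (a i) ∘ₗ φ i - φ i ∘ₗ Algebra.lsmul k k N (a i))
  map_add' φ φ' := by
    rw [← Finset.sum_add_distrib]
    refine Finset.sum_congr rfl fun i _ => ?_
    ext y
    simp
    abel
  map_smul' c φ := by
    rw [RingHom.id_apply, Finset.smul_sum]
    refine Finset.sum_congr rfl fun i _ => ?_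
    ext y
    simp [smul_sub, smul_algebra_smul_comm]

variable {N P}

@[simp]
theorem commutatorMap_apply (φ : ι → N →ₗ[k] P) (y : N) :
    commutatorMap a N P φ y = ∑ i, (a i • φ i y - φ i (a i • y)) := by
  simp [commutatorMap]

theorem commutatorMap_single [DecidableEq ι] (i : ι) (φ : N →ₗ[k] P) :
    commutatorMap a N P (Pi.single i φ) =
      Algebra.lsmul k k P (a i) ∘ₗ φ - φ ∘ₗ Algebra.lsmul k k N (a i) := by
  ext y
  rw [commutatorMap_apply, Finset.sum_eq_single i]
  · simp
  · intro j _ hj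
    simp [Pi.single_eq_of_ne hj]
  · simp

/-- Sums of commutators have trace zero, and some endomorphism has trace `1`. -/
theorem commutatorMap_not_surjective [Module.Finite k N] [Nontrivial N] :
    ¬ Function.Surjective (commutatorMap (k := k) a N N) := by
  intro hs
  obtain ⟨x, hx⟩ := exists_ne (0 : N)
  obtain ⟨f, hf⟩ : ∃ f : Module.Dual k N, f x ≠ 0 := by
    by_contra! h
    exact hx ((Module.forall_dual_apply_eq_zero_iff k x).mp h)
  obtain ⟨φ, hφ⟩ := hs (f.smulRight x)
  apply hf
  rw [← LinearMap.trace_smulRight f x, ← hφ]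
  simp only [commutatorMap, LinearMap.coe_mk, AddHom.coe_mk, map_sum, map_sub]
  refine Finset.sum_eq_zero fun i _ => sub_eq_zero.mpr ?_
  exact LinearMap.trace_mul_comm k _ _

/-- A functional killing all commutators is given by a linear map `P → N` commuting with every
`a i`, since the dual of `Hom(N, P)` is `Hom(P, N)`. -/
theorem exists_commuting_of_not_surjective [Module.Finite k N]
    (hs : ¬ Function.Surjective (commutatorMap (k := k) a N P)) :
    ∃ ψ : P →ₗ[k] N, ψ ≠ 0 ∧ ∀ i p, ψ (a i • p) = a i • ψ p := by
  classical
  obtain ⟨F, hF0, hF⟩ := Submodule.exists_le_ker_of_lt_top _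
    (lt_top_iff_ne_top.mpr (mt LinearMap.range_eq_top.mp hs))
  let θ : P →ₗ[k] Module.Dual k (Module.Dual k N) :=
    LinearMap.mk₂ k (fun p f => F (f.smulRight p))
      (fun p q f => by rw [← map_add]; congr 1; ext; simp)
      (fun c p f => by rw [← map_smul]; congr 1; ext; simpa using smul_comm _ _ _)
      (fun p f g => by rw [← map_add]; congr 1; ext; simp [add_smul])
      (fun c p f => by rw [← map_smul]; congr 1; ext; simp [mul_smul])
  let ψ : P →ₗ[k] N := (Module.evalEquiv k N).symm.toLinearMap ∘ₗ θ
  have hψ : ∀ p (f : Module.Dual k N), f (ψ p) = F (f.smulRight p) := fun p f => by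
    have : Module.evalEquiv k N (ψ p) = θ p := by simp [ψ]
    exact LinearMap.congr_fun this f
  refine ⟨ψ, ?_, ?_⟩
  · rintro h0
    apply hF0
    ext φ
    let b := Module.finBasis k N
    have hφ : φ = ∑ i, (b.coord i).smulRight (φ (b i)) := by
      refine b.ext fun j => ?_
      simp [LinearMap.sum_apply, Finsupp.single_apply]
    rw [hφ, map_sum]
    simp [← hψ, h0]
  · intro i p
    rw [← sub_eq_zero, ← Module.forall_dual_apply_eq_zero_iff k]
    intro f
    have h := hF (LinearMap.mem_range_self _ (Pi.single i (f.smulRight p)))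
    rw [commutatorMap_single, LinearMap.mem_ker, map_sub] at h
    have h1 : F (Algebra.lsmul k k P (a i) ∘ₗ f.smulRight p) = f (ψ (a i • p)) := by
      rw [hψ]
      congr 1
      ext y
      simpa using smul_comm _ _ _
    have h2 : F (f.smulRight p ∘ₗ Algebra.lsmul k k N (a i)) = f (a i • ψ p) := by
      have := hψ p (f ∘ₗ Algebra.lsmul k k N (a i))
      simp only [LinearMap.comp_apply, Algebra.lsmul_coe] at this
      rw [this]
      rfl
    rw [map_sub, ← h1, ← h2, h]

end Commutator

/-! ### A test module -/

section TestModule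

variable {k : Type u} {Λ : Type w} [Field k] [Ring Λ] [Algebra k Λ] {N M : Type v}
  [AddCommGroup N] [Module k N] [Module Λ N] [IsScalarTower k Λ N] [Module.Finite k N]
  [AddCommGroup M] [Module k M] [Module Λ M] [IsScalarTower k Λ M] [Module.Finite k M]

/-- The test module is the submodule of `Hom_k(W, N)`, with `W` the kernel of the commutator map
on `N`, generated by the evaluations `w ↦ w i y`. These satisfy the relations that define `W`, so
its homomorphisms into `M` embed into the kernel for `M`; its homomorphisms into `N` include the
evaluations at all points of `W`. -/
theorem HomLE.finrank_ker_commutatorMap_le (h : HomLE k Λ N M) {n : ℕ} (a : Fin n → Λ) :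
    Module.finrank k (LinearMap.ker (commutatorMap (k := k) a N N)) ≤
      Module.finrank k (LinearMap.ker (commutatorMap (k := k) a N M)) := by
  let W := LinearMap.ker (commutatorMap (k := k) a N N)
  let x : Fin n → N →ₗ[k] W →ₗ[k] N := fun i =>
    LinearMap.mk₂ k (fun y w => w.1 i y) (fun _ _ _ => by simp) (fun _ _ _ => by simp)
      (fun _ _ _ => by simp) (fun _ _ _ => by simp)
  have hx : ∀ i y w, x i y w = w.1 i y := fun _ _ _ => rfl
  let G : Set (W →ₗ[k] N) := Set.range fun q : Fin n × N => x q.1 q.2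
  let X : Submodule Λ (W →ₗ[k] N) := Submodule.span Λ G
  have hxX : ∀ i y, x i y ∈ X := fun i y => Submodule.subset_span ⟨(i, y), rfl⟩
  have : Module.Finite k X := Module.Finite.of_injective
    (X.subtype.restrictScalars k) X.injective_subtype
  have := finite_hom k Λ X N
  let gen : Fin n → N →ₗ[k] X := fun i => (x i).codRestrict (X.restrictScalars k) (hxX i)
  have hgen : ∀ i y, (gen i y : W →ₗ[k] N) = x i y := fun _ _ => rfl
  -- Evaluation at the points of `W`.
  have h1 : Module.finrank k W ≤ Module.finrank k (X →ₗ[Λ] N) := by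
    let ev : W →ₗ[k] X →ₗ[Λ] N :=
      { toFun := fun w =>
          { toFun := fun z => z.1 w
            map_add' := fun _ _ => rfl
            map_smul' := fun _ _ => rfl }
        map_add' := fun w w' => by ext z; exact map_add z.1 w w'
        map_smul' := fun c w => by ext z; exact map_smul z.1 c w }
    refine LinearMap.finrank_le_finrank_of_injective (f := ev) ?_
    intro w w' hw
    ext i y
    exact LinearMap.congr_fun hw (gen i y)
  have hrel : ∀ y, ∑ i, (a i • gen i y - gen i (a i • y)) = 0 := by
    intro y
    ext w
    have hw := LinearMap.congr_fun (LinearMap.mem_ker.mp w.2) y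
    rw [commutatorMap_apply] at hw
    simpa [hgen, hx, LinearMap.sum_apply] using hw
  -- Restriction to the generators.
  have h2 : Module.finrank k (X →ₗ[Λ] M) ≤
      Module.finrank k (LinearMap.ker (commutatorMap (k := k) a N M)) := by
    let res : (X →ₗ[Λ] M) →ₗ[k] LinearMap.ker (commutatorMap (k := k) a N M) :=
      { toFun := fun u => ⟨fun i => u.restrictScalars k ∘ₗ gen i, by
          rw [LinearMap.mem_ker]
          ext y
          have := congrArg u (hrel y)
          simpa using this⟩
        map_add' := fun _ _ => rfl
        map_smul' := fun _ _ => rfl }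
    refine LinearMap.finrank_le_finrank_of_injective (f := res) ?_
    intro u u' hu
    have hu' : ∀ i y, u (gen i y) = u' (gen i y) := fun i y =>
      LinearMap.congr_fun (congrFun (congrArg Subtype.val hu) i) y
    ext ⟨z, hz⟩
    induction hz using Submodule.span_induction with
    | mem z hz =>
      obtain ⟨⟨i, y⟩, rfl⟩ := hz
      exact hu' i y
    | zero => exact (map_zero u).trans (map_zero u').symm
    | add z z' hz hz' e e' =>
      exact (map_add u ⟨z, hz⟩ ⟨z', hz'⟩).trans
        ((congrArg₂ (· + ·) e e').trans (map_add u' ⟨z, hz⟩ ⟨z', hz'⟩).symm)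
    | smul c z hz e =>
      exact (map_smul u c ⟨z, hz⟩).trans
        ((congrArg (c • ·) e).trans (map_smul u' c ⟨z, hz⟩).symm)
  exact h1.trans ((h X).trans h2)

variable (k Λ N M) in
/-- Finitely many elements of `Λ` detect `Λ`-linearity of `k`-linear maps `M → N`: their images
span the image of `Λ` in `End_k(M × N)`. -/
theorem exists_finite_detecting_linear : ∃ (n : ℕ) (a : Fin n → Λ), ∀ ψ : M →ₗ[k] N,
    (∀ i m, ψ (a i • m) = a i • ψ m) → ∀ (c : Λ) m, ψ (c • m) = c • ψ m := by
  let ρ : Λ →ₗ[k] (M × N →ₗ[k] M × N) := (Algebra.lsmul k k (M × N)).toLinearMap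
  obtain ⟨n, b, hb⟩ := Submodule.fg_iff_exists_fin_generating_family.mp
    (IsNoetherian.noetherian (LinearMap.range ρ))
  have hbρ : ∀ i, ∃ c, ρ c = b i := fun i =>
    LinearMap.mem_range.mp (hb ▸ Submodule.subset_span (Set.mem_range_self i))
  choose a ha using hbρ
  refine ⟨n, a, fun ψ hψ c m => ?_⟩
  obtain ⟨t, ht⟩ := (Submodule.mem_span_range_iff_exists_fun k).mp
    (hb ▸ LinearMap.mem_range_self ρ c)
  have hc : ρ c = ρ (∑ i, t i • a i) := by
    rw [← ht, map_sum]
    simp only [map_smul, ha]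
  set d := ∑ i, t i • a i
  have hact : c • m = d • m ∧ c • ψ m = d • ψ m := by
    have := LinearMap.congr_fun hc (m, ψ m)
    exact Prod.ext_iff.mp this
  rw [hact.1, hact.2, Finset.sum_smul, Finset.sum_smul, map_sum]
  refine Finset.sum_congr rfl fun i _ => ?_
  rw [smul_assoc, smul_assoc, map_smul, hψ]

/-- If there were no nonzero map `M → N`, the commutator map would be surjective on `M` but
not on `N`, so its kernel would be larger on `N`, contrary to `N ≤_Hom M`. -/
theorem HomLE.exists_ne_zero [Nontrivial N] (hdim : Module.finrank k N = Module.finrank k M)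
    (h : HomLE k Λ N M) : ∃ g : M →ₗ[Λ] N, g ≠ 0 := by
  obtain ⟨n, a, ha⟩ := exists_finite_detecting_linear k Λ N M
  have hsurj : ¬ Function.Surjective (commutatorMap (k := k) a N M) := by
    intro hs
    have h1 := LinearMap.finrank_range_add_finrank_ker (commutatorMap (k := k) a N N)
    have h2 := LinearMap.finrank_range_add_finrank_ker (commutatorMap (k := k) a N M)
    have h3 := h.finrank_ker_commutatorMap_le a
    have h4 := Submodule.finrank_lt
      (mt LinearMap.range_eq_top.mp (commutatorMap_not_surjective (k := k) (N := N) a))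
    rw [LinearMap.range_eq_top.mpr hs, finrank_top] at h2
    simp only [Module.finrank_pi_fintype, Module.finrank_linearMap, hdim] at h1 h2 h4
    omega
  obtain ⟨ψ, hψ0, hψ⟩ := exists_commuting_of_not_surjective a hsurj
  refine ⟨{ ψ with map_smul' := ha ψ hψ }, fun h0 => hψ0 ?_⟩
  ext m
  exact LinearMap.congr_fun h0 m

end TestModule

/-! ### Minimality of bricks -/

/-- A nonzero `g : M → N` has an image `J` with `0 < dim Hom(J, N) ≤ dim Hom(J, M)`; composing
`M → J` with a nonzero `J → M` gives an automorphism of `M`, so `g` is injective. -/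
theorem isHomMinimal_of_isDivRing_end (k : Type u) (Λ : Type w) [Field k] [Ring Λ] [Algebra k Λ]
    (M : Type v) [AddCommGroup M] [Module k M] [Module Λ M] [IsScalarTower k Λ M]
    [Module.Finite k M] (hM : IsDivRing (Module.End Λ M)) : IsHomMinimal k Λ M := by
  intro N _ _ _ _ _ hdim h
  have : Nontrivial M := by
    by_contra hn
    rw [not_nontrivial_iff_subsingleton] at hn
    have := hM.1
    exact not_subsingleton (Module.End Λ M) inferInstance
  have : Nontrivial N := Module.nontrivial_of_finrank_pos (R := k) (hdim ▸ Module.finrank_pos)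
  obtain ⟨g, hg⟩ := h.exists_ne_zero hdim
  have : Module.Finite k (LinearMap.range g) := Module.Finite.of_injective
    ((LinearMap.range g).subtype.restrictScalars k) (LinearMap.range g).injective_subtype
  have := finite_hom k Λ (LinearMap.range g) N
  have hJN : 0 < Module.finrank k (LinearMap.range g →ₗ[Λ] N) := by
    refine Module.finrank_pos_iff_exists_ne_zero.mpr ⟨(LinearMap.range g).subtype, fun h0 => ?_⟩
    apply hg
    ext m
    exact LinearMap.congr_fun h0 (g.rangeRestrict m)
  have := Module.nontrivial_of_finrank_pos (hJN.trans_le (h (LinearMap.range g)))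
  obtain ⟨r, hr⟩ := exists_ne (0 : LinearMap.range g →ₗ[Λ] M)
  have hunit : IsUnit (r ∘ₗ g.rangeRestrict : Module.End Λ M) := by
    refine hM.2 _ fun h0 => hr ?_
    ext j
    obtain ⟨m, rfl⟩ := g.surjective_rangeRestrict j
    exact LinearMap.congr_fun h0 m
  have hinj : Function.Injective g := by
    have := ((Module.End.isUnit_iff _).mp hunit).1
    intro m m' hmm
    refine this ?_
    have : g.rangeRestrict m = g.rangeRestrict m' := Subtype.ext hmm
    simp [this]
  have hsurj : Function.Surjective g :=
    (LinearMap.injective_iff_surjective_of_finrank_eq_finrank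
      (f := g.restrictScalars k) hdim.symm).mp hinj
  exact ⟨(LinearEquiv.ofBijective g ⟨hinj, hsurj⟩).symm⟩

theorem mainTheorem3 (k : Type u) (Λ : Type w) [Field k] [Ring Λ] [Algebra k Λ]
    (M : Type v) [AddCommGroup M] [Module k M] [Module Λ M] [IsScalarTower k Λ M]
    [Module.Finite k M] (hM : IsDivRing (Module.End Λ M)) :
    IsHomMinimal k Λ M ∧ IsDegMinimal k Λ M := by
  have hmin := isHomMinimal_of_isDivRing_end k Λ M hM
  refine ⟨hmin, ?_⟩
  intro N _ _ _ _ _ h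
  exact hmin N h.finrank_eq h.homLE
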